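/- Let $F$ be a cumulative distribution function on $\mathbb{R}$ that is continuous and has full support on a compact interval (the support of $F$ is $[\ell,h]$), let $\tau\in(0,1)$, and let $v_S:\mathbb{R}\to\mathbb{R}$ be upper semicontinuous. Write $F^{-1}(\tau):=\inf\{x: F(x)\ge\tau\}$, \[ F_L^\tau(x):=\min\{F(x)/\tau,\,1\},\qquad F_R^\tau(x):=\max\{(F(x)-\tau)/(1-\tau),\,0\}, \] and let $\mathcal{I}(F_R^\tau,F_L^\tau)$ be the set of nondecreasing right-continuous functions $H:\mathbb{R}\to\mathbb{R}$ with $F_R^\tau\le H\le F_L^\tau$ pointwise. The quantile persuasion problem is \[ \sup_{H\in\mathcal{I}(F_R^\tau,F_L^\tau)}\int_{\mathbb{R}} v_S\,dH, \tag{P} \] where the integral takes values in $[-\infty,\infty)$; $H$ solves (P) if $H\in\mathcal{I}(F_R^\tau,F_L^\tau)$ and it attains this supremum. For $a\in\mathbb{R}$ let $H^L_a(x):=0$ for $x<a$ and $H^L_a(x):=F_L^\tau(x)$ for $x\ge a$; let $H^R_a(x):=F_R^\tau(x)$ for $x<a$ and $H^R_a(x):=1$ for $x\ge a$. For $\underline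 a\le\overline a$ with $F_L^\tau(\underline a)=F_R^\tau(\overline a)=:\eta$ let $H^C_{\underline a,\overline a}(x):=F_L^\tau(x)$ for $x<\underline a$, $:=\eta$ for $x\in[\underline a,\overline a)$, and $:=F_R^\tau(x)$ for $x\ge\overline a$. Then: (i) If $v_S$ is quasi-concave and attains its maximum at $a\le F^{-1}(\tau)$, then $H^L_a$ solves (P). (ii) If $v_S$ is quasi-concave and attains its maximum at $a>F^{-1}(\tau)$, then $H^R_a$ solves (P). (iii) If $v_S$ is strictly quasi-convex, that is, $v_S(sx+(1-s)y)<\max\{v_S(x),v_S(y)\}$ for all $x\ne y$ and $s\in(0,1)$, then $H^C_{\underline a,\overline a}$ solves (P) for some $\underline a\le\overline a$ with $F_L^\tau(\underline a)=F_R^\tau(\overline a)$. (iv) $F$ is never the unique solution of (P). -/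

import Mathlib

open Set Filter Topology MeasureTheory
open scoped ENNReal

noncomputable section

namespace QuantilePersuasion

/-- The set of nondecreasing right-continuous functions lying pointwise between `lower` and
`upper` (a nondecreasing right-continuous function is a `StieltjesFunction`). -/
def monotoneInterval (lower upper : ℝ → ℝ) : Set (StieltjesFunction ℝ) :=
  {H | ∀ x, lower x ≤ H x ∧ H x ≤ upper x}

/-- `G` is a cumulative distribution function. -/
def IsCDF (G : StieltjesFunction ℝ) : Prop :=
  Tendsto G atBot (𝓝 0) ∧ Tendsto G atTop (𝓝 1)

/-- The quantile function `G⁻¹(τ) = inf {x | G x ≥ τ}`. -/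
def quantile (G : ℝ → ℝ) (τ : ℝ) : ℝ := sInf {x | τ ≤ G x}

/-- Left truncation `min {F / τ, 1}` of the prior. -/
def leftTrunc (F : ℝ → ℝ) (τ : ℝ) (x : ℝ) : ℝ := min (1 / τ * F x) 1

/-- Right truncation `max {(F - τ) / (1 - τ), 0}` of the prior. -/
def rightTrunc (F : ℝ → ℝ) (τ : ℝ) (x : ℝ) : ℝ := max ((F x - τ) / (1 - τ)) 0

/-- The Lebesgue–Stieltjes integral `∫ v dH` as an extended real number, i.e. the integral of the
positive part minus the integral of the negative part. An upper semicontinuous `v` is bounded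
above on compact sets but possibly unbounded below, so the value may be `-∞`. -/
def payoff (v : ℝ → ℝ) (H : StieltjesFunction ℝ) : EReal :=
  ((∫⁻ x, ENNReal.ofReal (v x) ∂H.measure : ℝ≥0∞) : EReal) -
    ((∫⁻ x, ENNReal.ofReal (-v x) ∂H.measure : ℝ≥0∞) : EReal)

/-- The function `H` attains the supremum of `∫ v dH` over the monotone function interval between
the right truncation and the left truncation of the prior `F`. -/
def Solves (F : ℝ → ℝ) (τ : ℝ) (v H : ℝ → ℝ) : Prop :=
  ∃ G ∈ monotoneInterval (rightTrunc F τ) (leftTrunc F τ), (∀ x, G x = H x) ∧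
    payoff v G = ⨆ K ∈ monotoneInterval (rightTrunc F τ) (leftTrunc F τ), payoff v K

open Classical in
/-- `H^L_a`: zero below `a`, the left truncation from `a` on. -/
def HL (F : ℝ → ℝ) (τ a x : ℝ) : ℝ := if x < a then 0 else leftTrunc F τ x

open Classical in
/-- `H^R_a`: the right truncation below `a`, one from `a` on. -/
def HR (F : ℝ → ℝ) (τ a x : ℝ) : ℝ := if x < a then rightTrunc F τ x else 1

open Classical in
/-- `H^C_{a,b}`: the left truncation below `a`, the constant `η = F_L(a)` on `[a, b)`, the right
truncation from `b` on. It is used for `a ≤ b` with `F_L(a) = F_R(b)`. -/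
def HC (F : ℝ → ℝ) (τ a b x : ℝ) : ℝ :=
  if x < a then leftTrunc F τ x else if x < b then leftTrunc F τ a else rightTrunc F τ x

/-- Strict quasi-convexity: strictly between two distinct points, `v` is smaller than its larger
endpoint value. -/
def StrictQuasiconvex (v : ℝ → ℝ) : Prop :=
  ∀ x y : ℝ, x ≠ y → ∀ s t : ℝ, 0 < s → 0 < t → s + t = 1 →
    v (s * x + t * y) < max (v x) (v y)

end QuantilePersuasion

end

/-! The quantile function of a feasible `H` pushes the uniform law on `(0, 1)` forward to
`H.measure` (`map_quantile`), so the payoff is the integral of `v (quantile H u)` over `u`.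
Feasibility confines `quantile H u` to the interval between the quantiles `l u` and `r u` of the
left and right truncations. A feasible function whose quantile maximizes `v` on `[l u, r u]` for
almost every `u` is therefore optimal (`payoff_le_of_quantile`).

If `v` is single-peaked at `a`, the best point of `[l u, r u]` is the one nearest to `a`. When `a`
is at most the `τ`-quantile, this choice is `max a (l u)`, the quantile of `HL`; otherwise it is
`min a (r u)`, the quantile of `HR`. If `v` is strictly quasi-convex, an endpoint is best, and once
`r u` beats `l u` it does so for all larger `u` (`StrictQuasiconvex.le_of_lt`). One switch at a
level `η` is then optimal, which gives `HC`.

For non-uniqueness, a small band of mass of `F` just above the `τ`-quantile can be concentrated at a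
point where `v` is at least its average over the band. The result is feasible, differs from `F` and
pays no less (`exists_ne_payoff_ge`). -/

open Set Filter Topology MeasureTheory
open scoped ENNReal

namespace QuantilePersuasion

/-! ### Quantile functions and the uniform representation. -/

section Quantile

/-- The quantile function is the lower adjoint of the distribution function on `(0, 1)`. -/
lemma quantile_le_iff {H : StieltjesFunction ℝ} (hH : IsCDF H) {u : ℝ} (hu : u ∈ Ioo (0 : ℝ) 1)
    (x : ℝ) : quantile H u ≤ x ↔ u ≤ H x := by
  obtain ⟨y, hy⟩ := (hH.1.eventually_lt_const hu.1).exists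
  obtain ⟨z, hz⟩ := (hH.2.eventually_const_lt hu.2).exists
  have hne : {x | u ≤ H x}.Nonempty := ⟨z, hz.le⟩
  have hbdd : BddBelow {x | u ≤ H x} :=
    ⟨y, fun t ht => le_of_not_gt fun h => absurd (ht.trans (H.mono h.le)) (not_le.2 hy)⟩
  refine ⟨fun h => ?_, fun h => csInf_le hbdd h⟩
  have hq : u ≤ H (quantile H u) := by
    have hr : Tendsto H (𝓝[>] (quantile H u)) (𝓝 (H (quantile H u))) :=
      (H.right_continuous _).mono_left (nhdsWithin_mono _ Ioi_subset_Ici_self)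
    refine ge_of_tendsto hr (eventually_nhdsWithin_of_forall fun t ht => ?_)
    obtain ⟨s, hs, hst⟩ := (csInf_lt_iff hbdd hne).1 ht
    exact le_trans hs (H.mono hst.le)
  exact hq.trans (H.mono h)

lemma quantile_eq {H : StieltjesFunction ℝ} (hH : IsCDF H) {u : ℝ} (hu : u ∈ Ioo (0 : ℝ) 1)
    {q : ℝ} (hq : ∀ x, q ≤ x ↔ u ≤ H x) : quantile H u = q :=
  eq_of_forall_ge_iff fun x => (quantile_le_iff hH hu x).trans (hq x).symm

lemma le_apply_quantile {H : StieltjesFunction ℝ} (hH : IsCDF H) {u : ℝ}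
    (hu : u ∈ Ioo (0 : ℝ) 1) : u ≤ H (quantile H u) :=
  (quantile_le_iff hH hu _).1 le_rfl

lemma quantile_anti {H K : StieltjesFunction ℝ} (hH : IsCDF H) (hK : IsCDF K)
    (h : ∀ x, H x ≤ K x) {u : ℝ} (hu : u ∈ Ioo (0 : ℝ) 1) : quantile K u ≤ quantile H u :=
  (quantile_le_iff hK hu _).2 ((le_apply_quantile hH hu).trans (h _))

lemma monotoneOn_quantile {H : StieltjesFunction ℝ} (hH : IsCDF H) :
    MonotoneOn (quantile H) (Ioo 0 1) := fun _ hu _ hw huw =>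
  (quantile_le_iff hH hu _).2 (huw.trans (le_apply_quantile hH hw))

lemma aemeasurable_quantile {H : StieltjesFunction ℝ} (hH : IsCDF H) :
    AEMeasurable (quantile H) (volume.restrict (Ioo 0 1)) :=
  aemeasurable_restrict_of_monotoneOn measurableSet_Ioo (monotoneOn_quantile hH)

lemma IsCDF.nonneg {H : StieltjesFunction ℝ} (hH : IsCDF H) (x : ℝ) : 0 ≤ H x :=
  H.mono.le_of_tendsto hH.1 x

lemma IsCDF.le_one {H : StieltjesFunction ℝ} (hH : IsCDF H) (x : ℝ) : H x ≤ 1 :=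
  H.mono.ge_of_tendsto hH.2 x

/-- The quantile function pushes the uniform distribution forward to the distribution itself. -/
lemma map_quantile {H : StieltjesFunction ℝ} (hH : IsCDF H) :
    (volume.restrict (Ioo (0 : ℝ) 1)).map (quantile H) = H.measure := by
  have : IsFiniteMeasure H.measure := H.isFiniteMeasure hH.1 hH.2
  symm
  refine Measure.ext_of_Iic _ _ fun x => ?_
  rw [H.measure_Iic hH.1, Measure.map_apply_of_aemeasurable (aemeasurable_quantile hH)
    measurableSet_Iic, Measure.restrict_apply' measurableSet_Ioo, sub_zero]
  apply le_antisymm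
  -- The set lies between the open and the half-open interval from `0` to `H x`, which have the same
  -- volume.
  · have hs : Ioo 0 (H x) ⊆ quantile H ⁻¹' Iic x ∩ Ioo 0 1 := fun u hu => by
      have hu' : u ∈ Ioo (0 : ℝ) 1 := ⟨hu.1, hu.2.trans_le (hH.le_one x)⟩
      exact ⟨(quantile_le_iff hH hu' x).2 hu.2.le, hu'⟩
    simpa using measure_mono (μ := volume) hs
  · have hs : quantile H ⁻¹' Iic x ∩ Ioo 0 1 ⊆ Ioc 0 (H x) := fun u hu =>
      ⟨hu.2.1, (quantile_le_iff hH hu.2 x).1 hu.1⟩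
    simpa using measure_mono (μ := volume) hs

lemma lintegral_measure_eq_lintegral_quantile {H : StieltjesFunction ℝ} (hH : IsCDF H)
    {f : ℝ → ℝ≥0∞} (hf : Measurable f) :
    ∫⁻ x, f x ∂H.measure = ∫⁻ u in Ioo 0 1, f (quantile H u) := by
  rw [← map_quantile hH, lintegral_map' hf.aemeasurable (aemeasurable_quantile hH)]

end Quantile

/-! ### Payoffs as integrals over quantiles. -/

section Payoff

lemma payoff_eq_lintegral_quantile {H : StieltjesFunction ℝ} (hH : IsCDF H) {v : ℝ → ℝ}
    (hv : Measurable v) :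
    payoff v H = ((∫⁻ u in Ioo 0 1, ENNReal.ofReal (v (quantile H u)) : ℝ≥0∞) : EReal) -
      ((∫⁻ u in Ioo 0 1, ENNReal.ofReal (-v (quantile H u)) : ℝ≥0∞) : EReal) := by
  rw [payoff, lintegral_measure_eq_lintegral_quantile hH hv.ennreal_ofReal,
    lintegral_measure_eq_lintegral_quantile hH (f := fun x => ENNReal.ofReal (-v x))
      hv.neg.ennreal_ofReal]

/-- Positive and negative parts are compared separately, so no integrability is needed and infinite
values are allowed. -/
lemma payoff_le_of_quantile {H K : StieltjesFunction ℝ} (hH : IsCDF H) (hK : IsCDF K)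
    {v : ℝ → ℝ} (hv : Measurable v)
    (h : ∀ᵐ u ∂volume.restrict (Ioo (0 : ℝ) 1), v (quantile H u) ≤ v (quantile K u)) :
    payoff v H ≤ payoff v K := by
  rw [payoff_eq_lintegral_quantile hH hv, payoff_eq_lintegral_quantile hK hv]
  refine EReal.sub_le_sub ?_ ?_ <;> rw [EReal.coe_ennreal_le_coe_ennreal_iff]
  · exact lintegral_mono_ae (h.mono fun u hu => ENNReal.ofReal_le_ofReal hu)
  · exact lintegral_mono_ae (h.mono fun u hu => ENNReal.ofReal_le_ofReal (neg_le_neg hu))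

lemma payoff_eq_integral_quantile {H : StieltjesFunction ℝ} (hH : IsCDF H) {v : ℝ → ℝ}
    (hv : Measurable v) (hi : IntegrableOn (fun u => v (quantile H u)) (Ioo 0 1)) :
    payoff v H = ((∫ u in Ioo 0 1, v (quantile H u) : ℝ) : EReal) := by
  have h1 : ∫⁻ u in Ioo 0 1, ENNReal.ofReal (v (quantile H u)) ≠ ∞ := hi.lintegral_lt_top.ne
  have h2 : ∫⁻ u in Ioo 0 1, ENNReal.ofReal (-v (quantile H u)) ≠ ∞ :=
    hi.neg.lintegral_lt_top.ne
  rw [integral_eq_lintegral_pos_part_sub_lintegral_neg_part hi,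
    payoff_eq_lintegral_quantile hH hv, EReal.coe_sub, EReal.coe_ennreal_toReal h1,
    EReal.coe_ennreal_toReal h2]

/-- A function that is almost surely bounded above is integrable once its payoff is not `-∞`. -/
lemma integrableOn_quantile_of_payoff_ne_bot {H : StieltjesFunction ℝ} (hH : IsCDF H)
    {v : ℝ → ℝ} (hv : Measurable v) {C : ℝ} (hC : ∀ᵐ x ∂H.measure, v x ≤ C)
    (hb : payoff v H ≠ ⊥) : IntegrableOn (fun u => v (quantile H u)) (Ioo 0 1) := by
  have : IsFiniteMeasure H.measure := H.isFiniteMeasure hH.1 hH.2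
  have hpos : ∫⁻ x, ENNReal.ofReal (v x) ∂H.measure < ∞ :=
    (lintegral_mono_ae (hC.mono fun x hx => ENNReal.ofReal_le_ofReal hx)).trans_lt
      (by simpa using ENNReal.mul_lt_top ENNReal.ofReal_lt_top (measure_lt_top _ _))
  have hneg : ∫⁻ x, ENNReal.ofReal (-v x) ∂H.measure < ∞ :=
    lt_top_iff_ne_top.2 fun h => hb (by simp [payoff, h])
  have hint : Integrable v H.measure := by
    refine ⟨hv.aestronglyMeasurable, (hasFiniteIntegral_iff_norm v).2 ?_⟩
    refine lt_of_le_of_lt (lintegral_mono fun x => ?_)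
      ((lintegral_add_left hv.ennreal_ofReal _).trans_lt (ENNReal.add_lt_top.2 ⟨hpos, hneg⟩))
    rcases le_total 0 (v x) with h | h
    · simp [abs_of_nonneg h]
    · simp [abs_of_nonpos h]
  rw [← map_quantile hH] at hint
  exact hint.comp_aemeasurable (aemeasurable_quantile hH)

end Payoff

/-! ### Piecewise constructions. -/

section Glue

open Classical in
/-- Follow `f` strictly to the left of `a` and `g` from `a` on. -/
noncomputable def glue (f g : StieltjesFunction ℝ) (a : ℝ) (h : ∀ x < a, f x ≤ g a) :
    StieltjesFunction ℝ where
  toFun x := if x < a then f x else g x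
  mono' x y hxy := by
    dsimp only
    split_ifs with hx hy hy
    · exact f.mono hxy
    · exact (h x hx).trans (g.mono (not_lt.1 hy))
    · exact absurd (hxy.trans_lt hy) hx
    · exact g.mono hxy
  right_continuous' x := by
    by_cases hx : x < a
    · refine (f.right_continuous x).congr_of_eventuallyEq ?_ (if_pos hx)
      filter_upwards [mem_nhdsWithin_of_mem_nhds (Iio_mem_nhds hx)] with y hy using if_pos hy
    · refine (g.right_continuous x).congr (fun y hy => if_neg ?_) (if_neg hx)
      exact not_lt.2 ((not_lt.1 hx).trans hy)

lemma glue_of_lt {f g : StieltjesFunction ℝ} {a : ℝ} (h : ∀ x < a, f x ≤ g a) {x : ℝ}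
    (hx : x < a) : glue f g a h x = f x := if_pos hx

lemma glue_of_le {f g : StieltjesFunction ℝ} {a : ℝ} (h : ∀ x < a, f x ≤ g a) {x : ℝ}
    (hx : a ≤ x) : glue f g a h x = g x := if_neg (not_lt.2 hx)

/-- A continuous nondecreasing function as a Stieltjes function. -/
def ofContinuous (f : ℝ → ℝ) (hm : Monotone f) (hc : Continuous f) : StieltjesFunction ℝ :=
  ⟨f, hm, fun _ => hc.continuousWithinAt⟩

end Glue

/-! ### The two truncations and the feasible set. -/

section Truncation

variable {F : StieltjesFunction ℝ} {τ : ℝ}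

lemma leftTrunc_eq_one (hτ : τ ∈ Ioo (0 : ℝ) 1) {x : ℝ} (h : τ ≤ F x) : leftTrunc F τ x = 1 := by
  rwa [leftTrunc, min_eq_right_iff, one_div_mul_eq_div, one_le_div hτ.1]

lemma leftTrunc_nonneg (hF : IsCDF F) (hτ : τ ∈ Ioo (0 : ℝ) 1) (x : ℝ) : 0 ≤ leftTrunc F τ x :=
  le_min (mul_nonneg (one_div_nonneg.2 hτ.1.le) (hF.nonneg x)) zero_le_one

lemma leftTrunc_le_one (x : ℝ) : leftTrunc F τ x ≤ 1 := min_le_right _ _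

lemma rightTrunc_nonneg (x : ℝ) : 0 ≤ rightTrunc F τ x := le_max_right _ _

lemma rightTrunc_le_one (hF : IsCDF F) (hτ : τ ∈ Ioo (0 : ℝ) 1) (x : ℝ) :
    rightTrunc F τ x ≤ 1 := by
  refine max_le ((div_le_one (sub_pos.2 hτ.2)).2 ?_) zero_le_one
  linarith [hF.le_one x]

lemma rightTrunc_eq_zero (hτ : τ ∈ Ioo (0 : ℝ) 1) {x : ℝ} (h : F x ≤ τ) :
    rightTrunc F τ x = 0 :=
  max_eq_right (div_nonpos_of_nonpos_of_nonneg (sub_nonpos.2 h) (sub_nonneg.2 hτ.2.le))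

lemma monotone_leftTrunc (hτ : τ ∈ Ioo (0 : ℝ) 1) : Monotone (leftTrunc F τ) := fun _ _ h =>
  min_le_min_right _ (mul_le_mul_of_nonneg_left (F.mono h) (one_div_nonneg.2 hτ.1.le))

lemma monotone_rightTrunc (hτ : τ ∈ Ioo (0 : ℝ) 1) : Monotone (rightTrunc F τ) := fun _ _ h =>
  max_le_max_right _ (div_le_div_of_nonneg_right (sub_le_sub_right (F.mono h) _)
    (sub_nonneg.2 hτ.2.le))

lemma continuous_leftTrunc (hc : Continuous F) : Continuous (leftTrunc F τ) := by
  unfold leftTrunc; fun_prop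

lemma continuous_rightTrunc (hc : Continuous F) : Continuous (rightTrunc F τ) := by
  unfold rightTrunc; fun_prop

lemma apply_le_leftTrunc (hF : IsCDF F) (hτ : τ ∈ Ioo (0 : ℝ) 1) (x : ℝ) :
    F x ≤ leftTrunc F τ x := by
  refine le_min ?_ (hF.le_one x)
  rw [one_div_mul_eq_div, le_div_iff₀ hτ.1]
  exact mul_le_of_le_one_right (hF.nonneg x) hτ.2.le

lemma rightTrunc_le_apply (hF : IsCDF F) (hτ : τ ∈ Ioo (0 : ℝ) 1) (x : ℝ) :
    rightTrunc F τ x ≤ F x := by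
  refine max_le ?_ (hF.nonneg x)
  rw [div_le_iff₀ (sub_pos.2 hτ.2)]
  nlinarith [hF.le_one x, hτ.1]

lemma rightTrunc_le_leftTrunc (hF : IsCDF F) (hτ : τ ∈ Ioo (0 : ℝ) 1) (x : ℝ) :
    rightTrunc F τ x ≤ leftTrunc F τ x :=
  (rightTrunc_le_apply hF hτ x).trans (apply_le_leftTrunc hF hτ x)

lemma tendsto_leftTrunc_atBot (hF : IsCDF F) : Tendsto (leftTrunc F τ) atBot (𝓝 0) := by
  have := (hF.1.const_mul (1 / τ)).min (tendsto_const_nhds (x := (1 : ℝ)))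
  rwa [mul_zero, min_eq_left zero_le_one] at this

lemma tendsto_rightTrunc_atTop (hF : IsCDF F) (hτ : τ ∈ Ioo (0 : ℝ) 1) :
    Tendsto (rightTrunc F τ) atTop (𝓝 1) := by
  have := ((hF.2.sub_const τ).div_const (1 - τ)).max (tendsto_const_nhds (x := (0 : ℝ)))
  rwa [div_self (sub_pos.2 hτ.2).ne', max_eq_left zero_le_one] at this

lemma isCDF_of_mem (hF : IsCDF F) (hτ : τ ∈ Ioo (0 : ℝ) 1) {H : StieltjesFunction ℝ}
    (hH : H ∈ monotoneInterval (rightTrunc F τ) (leftTrunc F τ)) : IsCDF H :=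
  ⟨tendsto_of_tendsto_of_tendsto_of_le_of_le tendsto_const_nhds (tendsto_leftTrunc_atBot hF)
      (fun x => (rightTrunc_nonneg x).trans (hH x).1) fun x => (hH x).2,
    tendsto_of_tendsto_of_tendsto_of_le_of_le (tendsto_rightTrunc_atTop hF hτ)
      tendsto_const_nhds (fun x => (hH x).1) fun x => (hH x).2.trans (leftTrunc_le_one x)⟩

end Truncation

/-! ### Optimality of the candidates, and non-uniqueness of the prior. -/

section Optimality

lemma solves_of_forall_payoff_le {F v : ℝ → ℝ} {τ : ℝ} {G : StieltjesFunction ℝ}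
    (hG : G ∈ monotoneInterval (rightTrunc F τ) (leftTrunc F τ))
    (h : ∀ K ∈ monotoneInterval (rightTrunc F τ) (leftTrunc F τ), payoff v K ≤ payoff v G) :
    Solves F τ v G :=
  ⟨G, hG, fun _ => rfl, le_antisymm (le_iSup₂_of_le G hG le_rfl) (iSup₂_le h)⟩

lemma apply_eq_zero_of_lt {F : StieltjesFunction ℝ} (hF : IsCDF F) {lo hi : ℝ}
    (hs : F.measure.support = Icc lo hi) {x : ℝ} (hx : x < lo) : F x = 0 := by
  have hsub : Iic x ⊆ F.measure.supportᶜ := fun y hy h => by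
    rw [hs] at h
    exact absurd (h.1.trans hy) (not_le.2 hx)
  have h0 := measure_mono_null hsub Measure.measure_compl_support
  rw [F.measure_Iic hF.1, sub_zero, ENNReal.ofReal_eq_zero] at h0
  exact le_antisymm h0 (hF.nonneg x)

lemma apply_eq_one_of_lt {F : StieltjesFunction ℝ} (hF : IsCDF F) {lo hi : ℝ}
    (hs : F.measure.support = Icc lo hi) {x : ℝ} (hx : hi < x) : F x = 1 := by
  have hsub : Ioi x ⊆ F.measure.supportᶜ := fun y hy h => by
    rw [hs] at h
    exact absurd (hx.trans hy) (not_lt.2 h.2)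
  have h0 := measure_mono_null hsub Measure.measure_compl_support
  rw [F.measure_Ioi hF.2, ENNReal.ofReal_eq_zero] at h0
  exact le_antisymm (hF.le_one x) (by linarith)

lemma _root_.QuasiconcaveOn.antitoneOn_Ici_of_forall_le {v : ℝ → ℝ}
    (hv : QuasiconcaveOn ℝ univ v) {a : ℝ} (ha : ∀ x, v x ≤ v a) : AntitoneOn v (Ici a) :=
  fun _ hx y _ hxy => ((hv (v y)).ordConnected.out ⟨mem_univ a, ha y⟩ ⟨mem_univ y, le_rfl⟩
    ⟨hx, hxy⟩).2

lemma _root_.QuasiconcaveOn.monotoneOn_Iic_of_forall_le {v : ℝ → ℝ}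
    (hv : QuasiconcaveOn ℝ univ v) {a : ℝ} (ha : ∀ x, v x ≤ v a) : MonotoneOn v (Iic a) :=
  fun x _ _ hy hxy => ((hv (v x)).ordConnected.out ⟨mem_univ x, le_rfl⟩ ⟨mem_univ a, ha x⟩
    ⟨hxy, hy⟩).2

variable {F : StieltjesFunction ℝ} {τ : ℝ} {v : ℝ → ℝ}

/-- The bound on `a` makes the right truncation vanish below `a`, hence feasibility. A competitor's
quantile lies to the right of that of the left truncation, where `v` can only fall once past `a`. -/
lemma solves_HL (hF : IsCDF F) (hc : Continuous F) (hτ : τ ∈ Ioo (0 : ℝ) 1) (hv : Measurable v)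
    {a : ℝ} (hq : QuasiconcaveOn ℝ univ v) (hmax : ∀ x, v x ≤ v a) (ha : a ≤ quantile F τ) :
    Solves F τ v (HL F τ a) := by
  let L := ofContinuous (leftTrunc F τ) (monotone_leftTrunc hτ) (continuous_leftTrunc hc)
  have hL : L ∈ monotoneInterval (rightTrunc F τ) (leftTrunc F τ) := fun x =>
    ⟨rightTrunc_le_leftTrunc hF hτ x, le_rfl⟩
  have hglue : ∀ x < a, StieltjesFunction.const ℝ 0 x ≤ L a := fun x _ => leftTrunc_nonneg hF hτ a
  let G := glue (StieltjesFunction.const ℝ 0) L a hglue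
  have hlt : ∀ x < a, G x = 0 := fun x hx => glue_of_lt hglue hx
  have hle : ∀ x, a ≤ x → G x = L x := fun x hx => glue_of_le hglue hx
  have hG : G ∈ monotoneInterval (rightTrunc F τ) (leftTrunc F τ) := fun x => by
    rcases lt_or_ge x a with hx | hx
    · have hFx : F x ≤ τ := le_of_not_ge fun h =>
        not_lt.2 ((quantile_le_iff hF hτ x).2 h) (hx.trans_le ha)
      rw [hlt x hx, rightTrunc_eq_zero hτ hFx]
      exact ⟨le_rfl, leftTrunc_nonneg hF hτ x⟩
    · rw [hle x hx]
      exact hL x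
  refine solves_of_forall_payoff_le hG fun K hK => payoff_le_of_quantile (isCDF_of_mem hF hτ hK)
    (isCDF_of_mem hF hτ hG) hv ((ae_restrict_iff' measurableSet_Ioo).2 (.of_forall fun u hu => ?_))
  have hGu : quantile G u = max a (quantile L u) := quantile_eq (isCDF_of_mem hF hτ hG) hu
    fun x => by
      rw [max_le_iff, quantile_le_iff (isCDF_of_mem hF hτ hL) hu]
      rcases lt_or_ge x a with hx | hx
      · simp [hlt x hx, not_le.2 hx, hu.1]
      · simp [hle x hx, hx]
  rw [hGu]
  rcases le_total a (quantile L u) with h | h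
  · have hLK := quantile_anti (isCDF_of_mem hF hτ hK) (isCDF_of_mem hF hτ hL)
      (fun x => (hK x).2) hu
    rw [max_eq_right h]
    exact hq.antitoneOn_Ici_of_forall_le hmax h (h.trans hLK) hLK
  · rw [max_eq_left h]
    exact hmax _

lemma solves_HR (hF : IsCDF F) (hc : Continuous F) (hτ : τ ∈ Ioo (0 : ℝ) 1) (hv : Measurable v)
    {a : ℝ} (hq : QuasiconcaveOn ℝ univ v) (hmax : ∀ x, v x ≤ v a) (ha : quantile F τ < a) :
    Solves F τ v (HR F τ a) := by
  let R := ofContinuous (rightTrunc F τ) (monotone_rightTrunc hτ) (continuous_rightTrunc hc)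
  have hR : R ∈ monotoneInterval (rightTrunc F τ) (leftTrunc F τ) := fun x =>
    ⟨le_rfl, rightTrunc_le_leftTrunc hF hτ x⟩
  have hglue : ∀ x < a, R x ≤ StieltjesFunction.const ℝ 1 a := fun x _ =>
    rightTrunc_le_one hF hτ x
  let G := glue R (StieltjesFunction.const ℝ 1) a hglue
  have hlt : ∀ x < a, G x = R x := fun x hx => glue_of_lt hglue hx
  have hle : ∀ x, a ≤ x → G x = 1 := fun x hx => glue_of_le hglue hx
  have hG : G ∈ monotoneInterval (rightTrunc F τ) (leftTrunc F τ) := fun x => by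
    rcases lt_or_ge x a with hx | hx
    · rw [hlt x hx]
      exact hR x
    · rw [hle x hx, leftTrunc_eq_one hτ ((quantile_le_iff hF hτ x).1 (ha.le.trans hx))]
      exact ⟨rightTrunc_le_one hF hτ x, le_rfl⟩
  refine solves_of_forall_payoff_le hG fun K hK => payoff_le_of_quantile (isCDF_of_mem hF hτ hK)
    (isCDF_of_mem hF hτ hG) hv ((ae_restrict_iff' measurableSet_Ioo).2 (.of_forall fun u hu => ?_))
  have hGu : quantile G u = min a (quantile R u) := quantile_eq (isCDF_of_mem hF hτ hG) hu
    fun x => by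
      rw [min_le_iff, quantile_le_iff (isCDF_of_mem hF hτ hR) hu]
      rcases lt_or_ge x a with hx | hx
      · simp [hlt x hx, not_le.2 hx]
      · simp [hle x hx, hx, hu.2.le]
  rw [hGu]
  rcases le_total (quantile R u) a with h | h
  · have hKR := quantile_anti (isCDF_of_mem hF hτ hR) (isCDF_of_mem hF hτ hK)
      (fun x => (hK x).1) hu
    rw [min_eq_right h]
    exact hq.monotoneOn_Iic_of_forall_le hmax (hKR.trans h) h hKR
  · rw [min_eq_left h]
    exact hmax _

/-- Between two points a strictly quasi-convex function is at most the larger endpoint value. -/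
lemma StrictQuasiconvex.le_max (h : StrictQuasiconvex v) {x y z : ℝ} (hxz : x ≤ z) (hzy : z ≤ y) :
    v z ≤ max (v x) (v y) := by
  rcases hxz.eq_or_lt with rfl | hxz
  · exact le_max_left _ _
  rcases hzy.eq_or_lt with rfl | hzy
  · exact le_max_right _ _
  have hxy : 0 < y - x := by linarith
  have := h x y (by linarith) ((y - z) / (y - x)) ((z - x) / (y - x))
    (div_pos (by linarith) hxy) (div_pos (by linarith) hxy) (by field_simp; ring)
  have he : (y - z) / (y - x) * x + (z - x) / (y - x) * y = z := by field_simp; ring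
  rw [he] at this
  exact this.le

/-- Once the right endpoint is better than the left one, it stays so when both move right. -/
lemma StrictQuasiconvex.le_of_lt (h : StrictQuasiconvex v) {x y x' y' : ℝ} (hxy : x ≤ y)
    (hx : x ≤ x') (hy : y ≤ y') (hxy' : x' ≤ y') (hlt : v x < v y) : v x' ≤ v y' := by
  have h1 : v y ≤ v y' := (le_max_iff.1 (h.le_max hxy hy)).resolve_left (not_le.2 hlt)
  exact (h.le_max hx hxy').trans (max_le (hlt.le.trans h1) le_rfl)

lemma exists_leftTrunc_eq_rightTrunc_eq (hF : IsCDF F) (hc : Continuous F)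
    (hτ : τ ∈ Ioo (0 : ℝ) 1) {x y : ℝ} (hx : F x = 0) (hy : F y = 1) {η : ℝ}
    (hη : η ∈ Icc (0 : ℝ) 1) :
    ∃ a b, a ≤ b ∧ leftTrunc F τ a = η ∧ rightTrunc F τ b = η := by
  have hRx : rightTrunc F τ x = 0 := rightTrunc_eq_zero hτ (hx.trans_le hτ.1.le)
  have hRy : rightTrunc F τ y = 1 := by
    rw [rightTrunc, hy, div_self (sub_pos.2 hτ.2).ne', max_eq_left zero_le_one]
  have hLx : leftTrunc F τ x = 0 := by simp [leftTrunc, hx]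
  obtain ⟨b, hb⟩ := mem_range_of_exists_le_of_exists_ge (continuous_rightTrunc (τ := τ) hc)
    ⟨x, hRx.trans_le hη.1⟩ ⟨y, hη.2.trans_eq hRy.symm⟩
  -- Starting the intermediate value argument at `min x b` keeps the interval nonempty and forces `a
  -- ≤ b`.
  have h0 : leftTrunc F τ (min x b) ≤ η :=
    (monotone_leftTrunc hτ (min_le_left x b)).trans (hLx.trans_le hη.1)
  obtain ⟨a, ha, haη⟩ := intermediate_value_Icc (min_le_right x b)
    (continuous_leftTrunc (τ := τ) hc).continuousOn
    ⟨h0, hb.symm.trans_le (rightTrunc_le_leftTrunc hF hτ b)⟩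
  exact ⟨a, b, ha.2, haη, hb⟩

lemma exists_solves_HC (hF : IsCDF F) (hc : Continuous F) (hτ : τ ∈ Ioo (0 : ℝ) 1)
    (hv : Measurable v) (hq : StrictQuasiconvex v) {x y : ℝ} (hx : F x = 0) (hy : F y = 1) :
    ∃ a b, a ≤ b ∧ leftTrunc F τ a = rightTrunc F τ b ∧ Solves F τ v (HC F τ a b) := by
  let L := ofContinuous (leftTrunc F τ) (monotone_leftTrunc hτ) (continuous_leftTrunc hc)
  let R := ofContinuous (rightTrunc F τ) (monotone_rightTrunc hτ) (continuous_rightTrunc hc)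
  have hL : L ∈ monotoneInterval (rightTrunc F τ) (leftTrunc F τ) := fun x =>
    ⟨rightTrunc_le_leftTrunc hF hτ x, le_rfl⟩
  have hR : R ∈ monotoneInterval (rightTrunc F τ) (leftTrunc F τ) := fun x =>
    ⟨le_rfl, rightTrunc_le_leftTrunc hF hτ x⟩
  have hLc := isCDF_of_mem hF hτ hL
  have hRc := isCDF_of_mem hF hτ hR
  -- Levels at which the right endpoint wins; the switch is at the infimum. Inserting `1` gives the
  -- default `η = 1` when the right endpoint never wins.
  let S : Set ℝ := insert 1 {u ∈ Ioo (0 : ℝ) 1 | v (quantile L u) < v (quantile R u)}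
  have hS0 : ∀ u ∈ S, 0 ≤ u := by
    rintro u (rfl | hu)
    exacts [zero_le_one, hu.1.1.le]
  have hSb : BddBelow S := ⟨0, hS0⟩
  have hSn : S.Nonempty := ⟨1, mem_insert _ _⟩
  have hη : sInf S ∈ Icc (0 : ℝ) 1 := ⟨le_csInf hSn hS0, csInf_le hSb (mem_insert _ _)⟩
  obtain ⟨a, b, hab, ha, hb⟩ := exists_leftTrunc_eq_rightTrunc_eq hF hc hτ hx hy hη
  refine ⟨a, b, hab, ha.trans hb.symm, ?_⟩
  have hglue₁ : ∀ x < b, StieltjesFunction.const ℝ (leftTrunc F τ a) x ≤ R b := fun x _ =>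
    (ha.trans hb.symm).le
  let M := glue (StieltjesFunction.const ℝ (leftTrunc F τ a)) R b hglue₁
  have hMlt : ∀ x < b, M x = sInf S := fun x hx => (glue_of_lt hglue₁ hx).trans ha
  have hMle : ∀ x, b ≤ x → M x = R x := fun x hx => glue_of_le hglue₁ hx
  have hMη : ∀ x, sInf S ≤ M x := fun x => by
    rcases lt_or_ge x b with h | h
    · exact (hMlt x h).ge
    · rw [hMle x h]
      exact hb.symm.trans_le (R.mono h)
  have hglue₂ : ∀ x < a, L x ≤ M a := fun x hx => ((L.mono hx.le).trans_eq ha).trans (hMη a)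
  let G := glue L M a hglue₂
  have hGlt : ∀ x < a, G x = L x := fun x hx => glue_of_lt hglue₂ hx
  have hGmid : ∀ x, a ≤ x → x < b → G x = sInf S := fun x hax hxb =>
    (glue_of_le hglue₂ hax).trans (hMlt x hxb)
  have hGle : ∀ x, b ≤ x → G x = R x := fun x hx =>
    (glue_of_le hglue₂ (hab.trans hx)).trans (hMle x hx)
  have hLη : ∀ x, a ≤ x → sInf S ≤ L x := fun x hx => ha.symm.trans_le (L.mono hx)
  have hRη : ∀ x, x < b → R x ≤ sInf S := fun x hx => (R.mono hx.le).trans_eq hb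
  have hG : G ∈ monotoneInterval (rightTrunc F τ) (leftTrunc F τ) := fun x => by
    rcases lt_or_ge x a with h | h
    · rw [hGlt x h]
      exact hL x
    rcases lt_or_ge x b with h' | h'
    · rw [hGmid x h h']
      exact ⟨hRη x h', hLη x h⟩
    · rw [hGle x h']
      exact hR x
  have hGc := isCDF_of_mem hF hτ hG
  refine solves_of_forall_payoff_le hG fun K hK => ?_
  have hKc := isCDF_of_mem hF hτ hK
  refine payoff_le_of_quantile hKc hGc hv ((ae_restrict_iff' measurableSet_Ioo).2 ?_)
  -- Whether the infimum belongs to `S` is undetermined, so this single null level is discarded.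
  filter_upwards [Measure.ae_ne volume (sInf S)] with u hne hu
  have hLK := quantile_anti hKc hLc (fun x => (hK x).2) hu
  have hKR := quantile_anti hRc hKc (fun x => (hK x).1) hu
  refine (hq.le_max hLK hKR).trans ?_
  rcases lt_or_gt_of_ne hne with h | h
  · have hGu : quantile G u = quantile L u := quantile_eq hGc hu fun x => by
      rw [quantile_le_iff hLc hu]
      rcases lt_or_ge x a with h1 | h1
      · rw [hGlt x h1]
      · refine iff_of_true (h.le.trans (hLη x h1)) ?_
        exact h.le.trans ((hMη x).trans_eq (glue_of_le hglue₂ h1).symm)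
    rw [hGu]
    exact max_le le_rfl (not_lt.1 fun hlt =>
      notMem_of_lt_csInf h hSb (mem_insert_of_mem _ ⟨hu, hlt⟩))
  · have hGu : quantile G u = quantile R u := quantile_eq hGc hu fun x => by
      rw [quantile_le_iff hRc hu]
      rcases lt_or_ge x b with h1 | h1
      · refine iff_of_false (not_le.2 ((hRη x h1).trans_lt h)) (not_le.2 ?_)
        rcases lt_or_ge x a with h2 | h2
        · rw [hGlt x h2]
          exact ((L.mono h2.le).trans_eq ha).trans_lt h
        · rwa [hGmid x h2 h1]
      · rw [hGle x h1]
    rw [hGu]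
    obtain ⟨w, hw, hwu⟩ := (csInf_lt_iff hSb hSn).1 h
    rcases hw with rfl | hw
    · exact absurd hu.2 (not_lt.2 hwu.le)
    · exact max_le (hq.le_of_lt
        (quantile_anti hRc hLc (rightTrunc_le_leftTrunc hF hτ) hw.1)
        (monotoneOn_quantile hLc hw.1 hu hwu.le) (monotoneOn_quantile hRc hw.1 hu hwu.le)
        (hLK.trans hKR) hw.2) le_rfl

/-- Mass of `F` on `(c, d]` concentrated at a point `p`. -/
lemma exists_concentration (c d p : ℝ) (hp : p ∈ Ioc c d) :
    ∃ K : StieltjesFunction ℝ, (∀ x, x < c ∨ d ≤ x → K x = F x) ∧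
      (∀ x, c ≤ x → x < p → K x = F c) ∧ ∀ x, p ≤ x → x < d → K x = F d := by
  have h1 : ∀ x < d, StieltjesFunction.const ℝ (F d) x ≤ F d := fun x _ => le_rfl
  let K₁ := glue (StieltjesFunction.const ℝ (F d)) F d h1
  have hK₁ : K₁ p = F d := by
    rcases hp.2.lt_or_eq with h | h
    · exact glue_of_lt h1 h
    · rw [h]
      exact glue_of_le h1 le_rfl
  have h2 : ∀ x < p, StieltjesFunction.const ℝ (F c) x ≤ K₁ p := fun x _ =>
    (F.mono (hp.1.le.trans hp.2)).trans_eq hK₁.symm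
  let K₂ := glue (StieltjesFunction.const ℝ (F c)) K₁ p h2
  have h3 : ∀ x < c, F x ≤ K₂ c := fun x hx =>
    (F.mono hx.le).trans_eq (glue_of_lt h2 hp.1).symm
  refine ⟨glue F K₂ c h3, ?_, fun x hcx hxp => ?_, fun x hpx hxd => ?_⟩
  · rintro x (hx | hx)
    · exact glue_of_lt h3 hx
    · rw [glue_of_le h3 (hp.1.le.trans (hp.2.trans hx)), glue_of_le h2 (hp.2.trans hx),
        glue_of_le h1 hx]
  · rw [glue_of_le h3 hcx, glue_of_lt h2 hxp, StieltjesFunction.const_apply]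
  · rw [glue_of_le h3 (hp.1.le.trans hpx), glue_of_le h2 hpx, glue_of_lt h1 hxd,
      StieltjesFunction.const_apply]

/-- The unit mass at the `τ`-quantile is feasible. Hence an optimal `F` cannot have payoff `-∞`,
which yields the integrability needed for averaging. -/
lemma exists_payoff_ne_bot (hF : IsCDF F) (hτ : τ ∈ Ioo (0 : ℝ) 1) (hv : Measurable v) :
    ∃ K ∈ monotoneInterval (rightTrunc F τ) (leftTrunc F τ), payoff v K ≠ ⊥ := by
  have hglue : ∀ x < quantile F τ, StieltjesFunction.const ℝ 0 x ≤
      StieltjesFunction.const ℝ 1 (quantile F τ) := fun _ _ => zero_le_one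
  let K := glue (StieltjesFunction.const ℝ 0) (StieltjesFunction.const ℝ 1) (quantile F τ) hglue
  have hlt : ∀ x < quantile F τ, K x = 0 := fun x hx => glue_of_lt hglue hx
  have hle : ∀ x, quantile F τ ≤ x → K x = 1 := fun x hx => glue_of_le hglue hx
  have hK : K ∈ monotoneInterval (rightTrunc F τ) (leftTrunc F τ) := fun x => by
    rcases lt_or_ge x (quantile F τ) with h | h
    · rw [hlt x h, rightTrunc_eq_zero hτ
        (le_of_not_ge fun h' => not_lt.2 ((quantile_le_iff hF hτ x).2 h') h)]
      exact ⟨le_rfl, leftTrunc_nonneg hF hτ x⟩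
    · rw [hle x h, leftTrunc_eq_one hτ ((quantile_le_iff hF hτ x).1 h)]
      exact ⟨rightTrunc_le_one hF hτ x, le_rfl⟩
  have hKc := isCDF_of_mem hF hτ hK
  have hqK : ∀ u ∈ Ioo (0 : ℝ) 1, quantile K u = quantile F τ := fun u hu =>
    quantile_eq hKc hu fun x => by
      rcases lt_or_ge x (quantile F τ) with h | h
      · simp [hlt x h, not_le.2 h, hu.1]
      · simp [hle x h, h, hu.2.le]
  have hi : IntegrableOn (fun u => v (quantile K u)) (Ioo 0 1) :=
    (integrableOn_const (C := v (quantile F τ)) (by simp)).congr_fun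
      (fun u hu => by simp [hqK u hu]) measurableSet_Ioo
  exact ⟨K, hK, by rw [payoff_eq_integral_quantile hKc hv hi]; exact EReal.coe_ne_bot _⟩

lemma exists_ne_payoff_ge (hF : IsCDF F) (hc : Continuous F) (hτ : τ ∈ Ioo (0 : ℝ) 1)
    (hv : Measurable v) {x y : ℝ} (hx : F x = 0) (hy : F y = 1)
    (hi : IntegrableOn (fun u => v (quantile F u)) (Ioo 0 1)) :
    ∃ K ∈ monotoneInterval (rightTrunc F τ) (leftTrunc F τ), (∃ z, K z ≠ F z) ∧
      payoff v F ≤ payoff v K := by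
  have ⟨hτ0, hτ1⟩ := hτ
  -- The band of levels starts at `τ`, where the left truncation is already `1`. Its upper end is
  -- the level at which the right truncation reaches `τ = F c`, so any values in `[F c, 1]` on `[c,
  -- d)` are feasible.
  have hlt : τ < τ + τ * (1 - τ) := by nlinarith
  have hlt1 : τ + τ * (1 - τ) < 1 := by nlinarith
  obtain ⟨c, hFc⟩ := mem_range_of_exists_le_of_exists_ge hc ⟨x, hx.trans_le hτ0.le⟩
    ⟨y, hτ1.le.trans_eq hy.symm⟩
  obtain ⟨d, hFd⟩ := mem_range_of_exists_le_of_exists_ge hc ⟨x, hx.trans_le (hτ0.trans hlt).le⟩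
    ⟨y, hlt1.le.trans_eq hy.symm⟩
  have hFcd : F c < F d := by rwa [hFc, hFd]
  have hS : Ioc (F c) (F d) ⊆ Ioo 0 1 := fun u hu =>
    ⟨(hτ0.trans_eq hFc.symm).trans hu.1, hu.2.trans_lt (hFd.trans_lt hlt1)⟩
  -- Some level in the band has value at least the average; its quantile is the concentration point.
  obtain ⟨r, hr, hvr⟩ := exists_setAverage_le (μ := volume) (s := Ioc (F c) (F d))
    (f := fun u => v (quantile F u)) (by simpa using hFcd) (by simp) (hi.mono_set hS)
  set p := quantile F r
  have hp : p ∈ Ioc c d := ⟨not_le.1 fun h => not_le.2 hr.1 ((quantile_le_iff hF (hS hr) c).1 h),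
    (quantile_le_iff hF (hS hr) d).2 hr.2⟩
  obtain ⟨K, hKout, hKl, hKr⟩ := exists_concentration (F := F) c d p hp
  have hK : K ∈ monotoneInterval (rightTrunc F τ) (leftTrunc F τ) := fun z => by
    by_cases hz : z < c ∨ d ≤ z
    · rw [hKout z hz]
      exact ⟨rightTrunc_le_apply hF hτ z, apply_le_leftTrunc hF hτ z⟩
    · obtain ⟨hcz, hzd⟩ : c ≤ z ∧ z < d := by simpa using hz
      have hKz : F c ≤ K z ∧ K z ≤ 1 := by
        rcases lt_or_ge z p with h | h
        · rw [hKl z hcz h]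
          exact ⟨le_rfl, hF.le_one c⟩
        · rw [hKr z h hzd]
          exact ⟨hFcd.le, hF.le_one d⟩
      refine ⟨le_trans ?_ hKz.1, hKz.2.trans_eq
        (leftTrunc_eq_one hτ (hFc.symm.trans_le (F.mono hcz))).symm⟩
      refine max_le ?_ (hF.nonneg c)
      rw [div_le_iff₀ (sub_pos.2 hτ1), hFc]
      linarith [F.mono hzd.le]
  have hKc := isCDF_of_mem hF hτ hK
  have hKin : ∀ u ∈ Ioc (F c) (F d), quantile K u = p := fun u hu =>
    quantile_eq hKc (hS hu) fun z => by
      rcases lt_or_ge z c with h1 | h1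
      · rw [hKout z (.inl h1)]
        exact iff_of_false (not_le.2 (h1.trans hp.1))
          (not_le.2 ((F.mono h1.le).trans_lt hu.1))
      rcases lt_or_ge z p with h2 | h2
      · rw [hKl z h1 h2]
        exact iff_of_false (not_le.2 h2) (not_le.2 hu.1)
      rcases lt_or_ge z d with h3 | h3
      · rw [hKr z h2 h3]
        exact iff_of_true h2 hu.2
      · rw [hKout z (.inr h3)]
        exact iff_of_true h2 (hu.2.trans (F.mono h3))
  have hKeq : ∀ u ∈ Ioo (0 : ℝ) 1 \ Ioc (F c) (F d), quantile K u = quantile F u := fun u hu =>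
    quantile_eq hKc hu.1 fun z => by
      rw [quantile_le_iff hF hu.1]
      by_cases hz : z < c ∨ d ≤ z
      · rw [hKout z hz]
      obtain ⟨hcz, hzd⟩ : c ≤ z ∧ z < d := by simpa using hz
      have hFz : F c ≤ F z ∧ F z ≤ F d := ⟨F.mono hcz, F.mono hzd.le⟩
      have hKz : F c ≤ K z ∧ K z ≤ F d := by
        rcases lt_or_ge z p with h | h
        · rw [hKl z hcz h]
          exact ⟨le_rfl, hFcd.le⟩
        · rw [hKr z h hzd]
          exact ⟨hFcd.le, le_rfl⟩
      rcases le_or_gt u (F c) with h | h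
      · exact iff_of_true (h.trans hFz.1) (h.trans hKz.1)
      · have h' : F d < u := not_le.1 fun h' => hu.2 ⟨h, h'⟩
        exact iff_of_false (not_le.2 (hFz.2.trans_lt h')) (not_le.2 (hKz.2.trans_lt h'))
  have hiin : IntegrableOn (fun u => v (quantile K u)) (Ioc (F c) (F d)) :=
    (integrableOn_const (C := v p) (by simp)).congr_fun
      (fun u hu => by simp only [hKin u hu]) measurableSet_Ioc
  have hmeas : MeasurableSet (Ioo (0 : ℝ) 1 \ Ioc (F c) (F d)) :=
    measurableSet_Ioo.diff measurableSet_Ioc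
  have hiout : IntegrableOn (fun u => v (quantile K u)) (Ioo 0 1 \ Ioc (F c) (F d)) :=
    (hi.mono_set sdiff_subset).congr_fun (fun u hu => by simp only [hKeq u hu]) hmeas
  have hiK : IntegrableOn (fun u => v (quantile K u)) (Ioo 0 1) := by
    rw [← sdiff_union_of_subset hS]
    exact hiout.union hiin
  refine ⟨K, hK, ?_, ?_⟩
  -- If `K = F`, then `F` would jump at `p` from `F c` to `F d`, against continuity.
  · by_contra! h
    have hFp : F p = F d := by
      rcases hp.2.lt_or_eq with h' | h'
      · rw [← h p, hKr p le_rfl h']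
      · rw [h']
    obtain ⟨z, hz, hFz⟩ := intermediate_value_Ioo hp.1.le hc.continuousOn
      (show (F c + F d) / 2 ∈ Ioo (F c) (F p) by rw [hFp]; constructor <;> linarith)
    have := hKl z hz.1.le hz.2
    rw [h z] at this
    linarith
  · rw [payoff_eq_integral_quantile hF hv hi, payoff_eq_integral_quantile hKc hv hiK,
      EReal.coe_le_coe_iff]
    have e1 := setIntegral_sdiff (μ := volume) measurableSet_Ioc hi hS
    have e2 := setIntegral_sdiff (μ := volume) measurableSet_Ioc hiK hS
    have e3 : ∫ u in Ioo 0 1 \ Ioc (F c) (F d), v (quantile K u) =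
        ∫ u in Ioo 0 1 \ Ioc (F c) (F d), v (quantile F u) :=
      setIntegral_congr_fun hmeas fun u hu => by simp only [hKeq u hu]
    have e4 : ∫ u in Ioc (F c) (F d), v (quantile K u) = (F d - F c) * v p := by
      rw [setIntegral_congr_fun (g := fun _ => v p) measurableSet_Ioc
        fun u hu => by simp only [hKin u hu]]
      simp [hFcd.le]
    have e5 : ∫ u in Ioc (F c) (F d), v (quantile F u) ≤ (F d - F c) * v p := by
      rw [setAverage_eq, smul_eq_mul, Real.volume_real_Ioc_of_le hFcd.le,
        inv_mul_le_iff₀ (sub_pos.2 hFcd)] at hvr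
      exact hvr
    linarith

lemma setOf_solves_ne_singleton (hF : IsCDF F) (hc : Continuous F) {lo hi : ℝ}
    (hs : F.measure.support = Icc lo hi) (hτ : τ ∈ Ioo (0 : ℝ) 1) (hv : UpperSemicontinuous v) :
    {H : ℝ → ℝ | Solves F τ v H} ≠ {(F : ℝ → ℝ)} := by
  intro heq
  have hsol : (F : ℝ → ℝ) ∈ {H : ℝ → ℝ | Solves F τ v H} := heq ▸ mem_singleton _
  obtain ⟨G, -, hGF, hpay⟩ := hsol
  obtain rfl : G = F := StieltjesFunction.ext hGF
  have hmax : ∀ K ∈ monotoneInterval (rightTrunc G τ) (leftTrunc G τ), payoff v K ≤ payoff v G :=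
    fun K hK => hpay ▸ le_iSup₂_of_le K hK le_rfl
  obtain ⟨P, hP, hPb⟩ := exists_payoff_ne_bot (v := v) hF hτ hv.measurable
  -- Upper semicontinuity bounds `v` above on the compact support, so only the negative part could
  -- obstruct integrability.
  obtain ⟨C, hC⟩ := (hv.upperSemicontinuousOn (Icc lo hi)).bddAbove_of_isCompact isCompact_Icc
  have hae : ∀ᵐ x ∂G.measure, v x ≤ C := by
    filter_upwards [Measure.support_mem_ae (μ := G.measure)] with x hx
    exact hC ⟨x, hs ▸ hx, rfl⟩
  have hint := integrableOn_quantile_of_payoff_ne_bot hF hv.measurable hae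
    (ne_bot_of_le_ne_bot hPb (hmax P hP))
  obtain ⟨K, hK, ⟨z, hz⟩, hle⟩ := exists_ne_payoff_ge hF hc hτ hv.measurable
    (apply_eq_zero_of_lt hF hs (sub_one_lt lo)) (apply_eq_one_of_lt hF hs (lt_add_one hi)) hint
  have hKsol : (K : ℝ → ℝ) ∈ {H : ℝ → ℝ | Solves G τ v H} :=
    solves_of_forall_payoff_le hK fun J hJ => (hmax J hJ).trans hle
  rw [heq, mem_singleton_iff] at hKsol
  exact hz (congrFun hKsol z)

end Optimality

end QuantilePersuasion

theorem corollary4 (F : StieltjesFunction ℝ) (hF : QuantilePersuasion.IsCDF F)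
    (hFcont : Continuous F)
    (lo hi : ℝ) (hFsupp : F.measure.support = Set.Icc lo hi)
    (τ : ℝ) (hτ : τ ∈ Set.Ioo (0 : ℝ) 1)
    (v : ℝ → ℝ) (hv : UpperSemicontinuous v) :
    (∀ a : ℝ, QuasiconcaveOn ℝ Set.univ v → (∀ x, v x ≤ v a) →
      a ≤ QuantilePersuasion.quantile F τ →
      QuantilePersuasion.Solves F τ v (QuantilePersuasion.HL F τ a)) ∧
    (∀ a : ℝ, QuasiconcaveOn ℝ Set.univ v → (∀ x, v x ≤ v a) →
      QuantilePersuasion.quantile F τ < a →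
      QuantilePersuasion.Solves F τ v (QuantilePersuasion.HR F τ a)) ∧
    (QuantilePersuasion.StrictQuasiconvex v →
      ∃ a b : ℝ, a ≤ b ∧
        QuantilePersuasion.leftTrunc F τ a = QuantilePersuasion.rightTrunc F τ b ∧
        QuantilePersuasion.Solves F τ v (QuantilePersuasion.HC F τ a b)) ∧
    {H : ℝ → ℝ | QuantilePersuasion.Solves F τ v H} ≠ {(F : ℝ → ℝ)} := by
  have hvm := hv.measurable
  exact ⟨fun a hq hmax ha => QuantilePersuasion.solves_HL hF hFcont hτ hvm hq hmax ha,
    fun a hq hmax ha => QuantilePersuasion.solves_HR hF hFcont hτ hvm hq hmax ha,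
    fun hq => QuantilePersuasion.exists_solves_HC hF hFcont hτ hvm hq
      (QuantilePersuasion.apply_eq_zero_of_lt hF hFsupp (sub_one_lt lo))
      (QuantilePersuasion.apply_eq_one_of_lt hF hFsupp (lt_add_one hi)),
    QuantilePersuasion.setOf_solves_ne_singleton hF hFcont hFsupp hτ hv⟩
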